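/- Let $n\ge 2$, let $S\subseteq\mathbb{R}^{n-1}$ be non-empty and let $p_0\in S$. Write $\mathbb{H}_{++}=\{x\in\mathbb{R}^n : x_n>0\}$ and identify $\mathbb{R}^{n-1}$ with the hyperplane $\{x_n=0\}\subset\mathbb{R}^n$. For $p\in S$ let $\mathcal{R}_p$ be the set of rays in $\mathbb{H}_{++}$ originating at $p$, topologized as a subspace of the projective space of lines in $\mathbb{R}^n$ through $p$. The bordered Prüfer manifold $\mathrm{PF}^n_{S,\partial}$ is the set $\mathbb{H}_{++}\sqcup\coprod_{p\in S}\mathcal{R}_p$ with the topology in which $\mathbb{H}_{++}$ is open and has its usual topology, a set $U$ is a neighbourhood of $r\in\mathcal{R}_p$ if and only if $U\cap\mathcal{R}_p$ is a neighbourhood of $r$ in $\mathcal{R}_p$ and $U\cap\mathbb{H}_{++}$ eventually contains every net $(x_\lambda)$ in $\mathbb{H}_{++}$ such that $x_\lambda\to p$ in $\mathbb{R}^n$ and the rays $\overrightarrow{px_\lambda}$ converge to $r$ in $\mathcal{R}_p$. The Prüfer $n$-manifold $\mathrm{PF}^n_S$ is the double of $\mathrm{PF}^n_{S,\partial}$,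 that is, two copies of it glued along their boundary $\bigcup_{p\in S}\mathcal{R}_p$. For distinct $p,q\in S$ let $\alpha^+_{p,q}$ be the path in $\mathrm{PF}^n_{S,\partial}$ from the vertical ray at $p$ to the vertical ray at $q$ that traverses, inside $\mathbb{H}_{++}$, the semicircle orthogonal to $\{x_n=0\}$ with diameter the segment $\overline{pq}$. Let $\alpha_{p,q}$ be the loop in $\mathrm{PF}^n_S$, based at the vertical ray at $p$, that runs along $\alpha^+_{p,q}$ in the first copy of $\mathrm{PF}^n_{S,\partial}$ and then back along the reversal of $\alpha^+_{p,q}$ in the second copy. Then, with the vertical ray at $p_0$ as base point, $\pi_1(\mathrm{PF}^n_S)$ is free on the classes of the loops $\alpha_{p_0,p}$, $p\in S^\times:=S\setminus\{p_0\}$: there is an isomorphism from the free group $F_{S^\times}$ onto $\pi_1(\mathrm{PF}^n_S)$ that maps each free generator $p\in S^\times$ to the class of $\alpha_{p_0,p}$. -/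

import Mathlib

open Set Filter Topology

open scoped unitInterval LinearAlgebra.Projectivization

noncomputable section

/-- The projective space of lines through the origin of a real topological vector space carries
the quotient topology from the space of non-zero vectors. -/
instance projectivizationTopology (V : Type*) [AddCommGroup V] [Module ℝ V]
    [TopologicalSpace V] : TopologicalSpace (ℙ ℝ V) :=
  inferInstanceAs (TopologicalSpace (Quotient (projectivizationSetoid ℝ V)))

namespace Pruefer

/-- The boundary hyperplane `ℝ^{n-1}` of the half-space in `ℝ^n`. -/
abbrev Hyperplane (n : ℕ) : Type := EuclideanSpace ℝ (Fin (n - 1))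

/-- `ℝ^n = ℝ^{n-1} × ℝ`; the second component is the last coordinate `x_n`, and a point `p` of the
boundary hyperplane is `(p, 0)`. -/
abbrev Ambient (n : ℕ) : Type := Hyperplane n × ℝ

/-- The strict upper half-space `x_n > 0`, with the subspace topology. -/
abbrev UpperHalf (n : ℕ) : Type := {x : Ambient n // 0 < x.2}

/-- The rays in the upper half-space from a given point `p` of the boundary hyperplane: such a ray
is the upper half of a unique line through `p` that is not contained in the hyperplane, and it is
recorded by the direction of that line. The topology is that of a subspace of the projective
space. -/
abbrev Ray (n : ℕ) : Type :=
  {l : ℙ ℝ (Ambient n) //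
    ¬ l.submodule ≤ LinearMap.ker (LinearMap.snd ℝ (Hyperplane n) ℝ)}

variable {n : ℕ}

/-- The ray with direction vector `v`, where `v` points upwards. -/
def rayOf (v : UpperHalf n) : Ray n :=
  ⟨Projectivization.mk ℝ v.1 (fun h => by
      have hv := v.2
      rw [h] at hv
      exact lt_irrefl _ hv), by
    rw [Projectivization.submodule_mk, Submodule.span_singleton_le_iff_mem, LinearMap.mem_ker]
    exact ne_of_gt v.2⟩

/-- The vertical ray. -/
def verticalRay (n : ℕ) : Ray n := rayOf ⟨(0, 1), one_pos⟩

/-- The ray from the boundary point `p` through the point `x` of the upper half-space. -/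
def rayThrough (p : Hyperplane n) (x : UpperHalf n) : Ray n :=
  rayOf ⟨x.1 - (p, 0), by simpa using x.2⟩

theorem continuous_rayOf : Continuous (rayOf : UpperHalf n → Ray n) := by
  refine Continuous.subtype_mk ?_ _
  have h1 : Continuous (fun v : {w : Ambient n // w ≠ 0} => Projectivization.mk ℝ v.1 v.2) :=
    continuous_quotient_mk'
  have h2 : Continuous (fun v : UpperHalf n => (⟨v.1, fun h => by
      have hv := v.2
      rw [h] at hv
      exact lt_irrefl _ hv⟩ : {w : Ambient n // w ≠ 0})) :=
    Continuous.subtype_mk continuous_subtype_val _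
  exact h1.comp h2

theorem continuous_rayThrough (p : Hyperplane n) : Continuous (rayThrough p) :=
  continuous_rayOf.comp
    (Continuous.subtype_mk (continuous_subtype_val.sub continuous_const) _)

theorem rayOf_eq_of_smul (v w : UpperHalf n) (c : ℝ) (h : c • w.1 = v.1) : rayOf v = rayOf w :=
  Subtype.ext ((Projectivization.mk_eq_mk_iff' ℝ _ _ _ _).2 ⟨c, h⟩)

/-- The set underlying the bordered Prüfer manifold: the disjoint union of the strict upper
half-space and, for every `p ∈ S`, the set of rays originating at `p`. -/
inductive Bordered (n : ℕ) (S : Set (Hyperplane n)) : Type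
  | inner (x : UpperHalf n) : Bordered n S
  | ray (p : S) (r : Ray n) : Bordered n S

/-- The filter of tangential convergence, for points `x` of the upper half-space, to the ray `r`
at `p`: `x → p` in the usual topology and `rayThrough p x → r`. -/
def tangential (p : Hyperplane n) (r : Ray n) : Filter (UpperHalf n) :=
  comap (Subtype.val : UpperHalf n → Ambient n) (𝓝 (p, 0)) ⊓ comap (rayThrough p) (𝓝 r)

namespace Bordered

variable {S : Set (Hyperplane n)}

/-- The topology of the bordered Prüfer manifold: the upper half-space is open and has its usual
topology, and a neighbourhood of the ray `r` at `p` consists of a neighbourhood of `r` among the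
rays at `p`, together with a set that eventually contains the nets converging tangentially to `r`
(see `nhds_ray` and `tendsto_inner_nhds_ray`). -/
instance : TopologicalSpace (Bordered n S) where
  IsOpen U := IsOpen (inner ⁻¹' U) ∧
    ∀ (p : S) (r : Ray n), ray p r ∈ U → ray p ⁻¹' U ∈ 𝓝 r ∧ inner ⁻¹' U ∈ tangential p.1 r
  isOpen_univ := ⟨isOpen_univ, fun _ _ _ => ⟨univ_mem, univ_mem⟩⟩
  isOpen_inter U V hU hV := ⟨hU.1.inter hV.1, fun p r h =>
    ⟨inter_mem (hU.2 p r h.1).1 (hV.2 p r h.2).1, inter_mem (hU.2 p r h.1).2 (hV.2 p r h.2).2⟩⟩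
  isOpen_sUnion T hT := by
    refine ⟨?_, ?_⟩
    · rw [preimage_sUnion]
      exact isOpen_biUnion fun U hU => (hT U hU).1
    · rintro p r ⟨U, hU, hr⟩
      exact ⟨mem_of_superset ((hT U hU).2 p r hr).1 fun _ h => ⟨U, hU, h⟩,
        mem_of_superset ((hT U hU).2 p r hr).2 fun _ h => ⟨U, hU, h⟩⟩

theorem isOpen_iff {U : Set (Bordered n S)} : IsOpen U ↔ IsOpen (inner ⁻¹' U) ∧
    ∀ (p : S) (r : Ray n), ray p r ∈ U → ray p ⁻¹' U ∈ 𝓝 r ∧ inner ⁻¹' U ∈ tangential p.1 r :=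
  Iff.rfl

theorem continuous_inner : Continuous (inner : UpperHalf n → Bordered n S) :=
  ⟨fun _ hU => hU.1⟩

theorem nhds_inner (x : UpperHalf n) : 𝓝 (inner x : Bordered n S) = map inner (𝓝 x) := by
  refine le_antisymm ?_ continuous_inner.continuousAt
  intro s hs
  obtain ⟨V, hVs, hV, hx⟩ := mem_nhds_iff.1 (mem_map.1 hs)
  refine mem_nhds_iff.2 ⟨inner '' V, image_subset_iff.2 hVs, ⟨?_, ?_⟩, ⟨x, hx, rfl⟩⟩
  · rwa [preimage_image_eq V fun a b h => by injection h]
  · rintro p r ⟨y, -, hy⟩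
    cases hy

theorem nhds_ray (p : S) (r : Ray n) :
    𝓝 (ray p r : Bordered n S) = map (ray p) (𝓝 r) ⊔ map inner (tangential p.1 r) := by
  refine le_antisymm ?_ ?_
  · rintro s ⟨hs1, hs2⟩
    obtain ⟨B', hB's, hB', hrB'⟩ := mem_nhds_iff.1 (mem_map.1 hs1)
    obtain ⟨t₁, ⟨a, ha, hat⟩, t₂, ⟨b, hb, hbt⟩, hst⟩ := mem_inf_iff.1 (mem_map.1 hs2)
    obtain ⟨A, hAa, hA, hpA⟩ := mem_nhds_iff.1 ha
    obtain ⟨B, hBb, hB, hrB⟩ := mem_nhds_iff.1 hb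
    have hin : (inner : UpperHalf n → Bordered n S) ⁻¹'
        (inner '' (Subtype.val ⁻¹' A ∩ rayThrough p.1 ⁻¹' (B ∩ B')) ∪ ray p '' (B ∩ B')) =
        Subtype.val ⁻¹' A ∩ rayThrough p.1 ⁻¹' (B ∩ B') := by
      ext x
      constructor
      · rintro (⟨y, hy, h⟩ | ⟨y, hy, h⟩)
        · injection h with h
          exact h ▸ hy
        · cases h
      · exact fun h => Or.inl ⟨x, h, rfl⟩
    refine mem_nhds_iff.2 ⟨inner '' (Subtype.val ⁻¹' A ∩ rayThrough p.1 ⁻¹' (B ∩ B')) ∪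
      ray p '' (B ∩ B'), ?_, isOpen_iff.2 ⟨?_, ?_⟩, Or.inr ⟨r, ⟨hrB, hrB'⟩, rfl⟩⟩
    · rintro _ (⟨x, ⟨hxA, hxB⟩, rfl⟩ | ⟨x, ⟨-, hx⟩, rfl⟩)
      · have : x ∈ t₁ ∩ t₂ := ⟨hat (hAa hxA), hbt (hBb hxB.1)⟩
        rw [← hst] at this
        exact this
      · exact hB's hx
    · rw [hin]
      exact (hA.preimage continuous_subtype_val).inter
        ((hB.inter hB').preimage (continuous_rayThrough _))
    · rintro q r' (⟨x, -, h⟩ | ⟨r'', hr'', h⟩)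
      · cases h
      · injection h with h1 h2
        subst h1 h2
        refine ⟨mem_of_superset ((hB.inter hB').mem_nhds hr'') fun y hy => Or.inr ⟨y, hy, rfl⟩, ?_⟩
        rw [hin]
        exact inter_mem_inf (preimage_mem_comap (hA.mem_nhds hpA))
          (preimage_mem_comap ((hB.inter hB').mem_nhds hr''))
  · intro s hs
    obtain ⟨U, hUs, hU, hr⟩ := mem_nhds_iff.1 hs
    exact ⟨mem_of_superset (hU.2 p r hr).1 fun _ h => hUs h,
      mem_of_superset (hU.2 p r hr).2 fun _ h => hUs h⟩

/-- A net in the upper half-space converges to the ray `r` at `p` precisely when it converges to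
`p` in the usual topology and the rays from `p` through its members converge to `r`. -/
theorem tendsto_inner_nhds_ray {ι : Type*} {l : Filter ι} {x : ι → UpperHalf n} {p : S}
    {r : Ray n} : Tendsto (fun i => (inner (x i) : Bordered n S)) l (𝓝 (ray p r)) ↔
      Tendsto (fun i => (x i).1) l (𝓝 (p.1, 0)) ∧
        Tendsto (fun i => rayThrough p.1 (x i)) l (𝓝 r) := by
  have h : comap (inner : UpperHalf n → Bordered n S) (𝓝 (ray p r)) = tangential p.1 r := by
    have hd : comap (inner : UpperHalf n → Bordered n S) (map (ray p) (𝓝 r)) = ⊥ := by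
      rw [← empty_mem_iff_bot]
      refine ⟨range (ray p), range_mem_map, ?_⟩
      rintro y ⟨z, hz⟩
      cases hz
    rw [nhds_ray, comap_sup, hd, bot_sup_eq]
    exact comap_map fun a b h => by injection h
  have h' := tendsto_comap_iff (f := x) (g := (inner : UpperHalf n → Bordered n S)) (a := l)
    (c := 𝓝 (ray p r))
  rw [h, tangential, tendsto_inf, tendsto_comap_iff, tendsto_comap_iff] at h'
  exact h'.symm

/-- The boundary of the bordered Prüfer manifold: the union of the sets of rays. -/
def boundary (n : ℕ) (S : Set (Hyperplane n)) : Set (Bordered n S) :=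
  {x | ∃ (p : S) (r : Ray n), x = ray p r}

end Bordered

/-- The point at time `t` of the semicircle in the closed upper half-space, orthogonal to the
boundary hyperplane, that has the segment from `p` to `q` as its diameter and runs from `p`
to `q`. -/
def semicircle (p q : Hyperplane n) (t : I) : Ambient n :=
  ((1 / 2 : ℝ) • (p + q) + (Real.cos (Real.pi * t) / 2) • (p - q),
    ‖p - q‖ / 2 * Real.sin (Real.pi * t))

variable {S : Set (Hyperplane n)}

/-- The semicircle from `p` to `q`, as a map into the bordered Prüfer manifold: the points on the
boundary hyperplane are replaced by the vertical rays at `p` and at `q`. For `p = q` all points are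
on the boundary hyperplane and the map is constant at the vertical ray. -/
def alphaPlusFun (p q : S) (t : I) : Bordered n S :=
  if h : 0 < (semicircle p.1 q.1 t).2 then .inner ⟨semicircle p.1 q.1 t, h⟩
  else if t = 0 then .ray p (verticalRay n) else .ray q (verticalRay n)

theorem semicircle_height_pos {p q : Hyperplane n} (hpq : p ≠ q) {t : I} (h0 : t ≠ 0)
    (h1 : t ≠ 1) : 0 < (semicircle p q t).2 := by
  have ht0 : 0 < (t : ℝ) := lt_of_le_of_ne t.2.1 fun h => h0 (Subtype.ext h.symm)
  have ht1 : (t : ℝ) < 1 := lt_of_le_of_ne t.2.2 fun h => h1 (Subtype.ext h)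
  have := norm_pos_iff.2 (sub_ne_zero.2 hpq)
  have hs : 0 < Real.sin (Real.pi * t) :=
    Real.sin_pos_of_pos_of_lt_pi (by positivity) (by nlinarith [Real.pi_pos])
  exact mul_pos (by positivity) hs

theorem alphaPlusFun_of_pos {p q : S} {t : I} (h : 0 < (semicircle p.1 q.1 t).2) :
    alphaPlusFun p q t = .inner ⟨semicircle p.1 q.1 t, h⟩ := dif_pos h

theorem alphaPlusFun_zero (p q : S) : alphaPlusFun p q 0 = .ray p (verticalRay n) := by
  simp [alphaPlusFun, semicircle]

theorem alphaPlusFun_one (p q : S) : alphaPlusFun p q 1 = .ray q (verticalRay n) := by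
  simp [alphaPlusFun, semicircle]

theorem alphaPlusFun_self (p : S) (t : I) : alphaPlusFun p p t = .ray p (verticalRay n) := by
  simp [alphaPlusFun, semicircle]

theorem semicircle_symm (p q : Hyperplane n) (t : I) :
    semicircle p q (unitInterval.symm t) = semicircle q p t := by
  have h : Real.pi * (1 - (t : ℝ)) = Real.pi - Real.pi * t := by ring
  simp only [semicircle, unitInterval.coe_symm_eq, h, Real.cos_pi_sub, Real.sin_pi_sub,
    norm_sub_rev p q, add_comm p q, Prod.mk.injEq, and_true]
  congr 1
  rw [← neg_sub q p, smul_neg, neg_div, neg_smul, neg_neg]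

theorem alphaPlusFun_symm (p q : S) (t : I) :
    alphaPlusFun p q (unitInterval.symm t) = alphaPlusFun q p t := by
  by_cases h0 : t = 0
  · subst h0
    rw [unitInterval.symm_zero, alphaPlusFun_zero, alphaPlusFun_one]
  by_cases h1 : t = 1
  · subst h1
    rw [unitInterval.symm_one, alphaPlusFun_zero, alphaPlusFun_one]
  by_cases hpq : p = q
  · subst hpq
    rw [alphaPlusFun_self, alphaPlusFun_self]
  have h := semicircle_height_pos (fun h => hpq (Subtype.ext h.symm)) h0 h1
  have h' := h
  rw [← semicircle_symm] at h'
  rw [alphaPlusFun_of_pos h, alphaPlusFun_of_pos h']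
  simp only [semicircle_symm]

theorem continuous_semicircle (p q : Hyperplane n) : Continuous (semicircle p q) := by
  unfold semicircle
  fun_prop

theorem continuousAt_alphaPlusFun_zero {p q : S} (hpq : p ≠ q) :
    ContinuousAt (alphaPlusFun p q) 0 := by
  have hpq' : p.1 ≠ q.1 := fun h => hpq (Subtype.ext h)
  have hd : 0 < ‖p.1 - q.1‖ := norm_pos_iff.2 (sub_ne_zero.2 hpq')
  rw [ContinuousAt, ← nhdsNE_sup_pure, tendsto_sup]
  refine ⟨?_, tendsto_pure_nhds _ _⟩
  rw [alphaPlusFun_zero]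
  have hne1 : ∀ᶠ t : I in 𝓝[≠] 0, t ≠ 1 :=
    eventually_nhdsWithin_of_eventually_nhds (isOpen_ne.mem_nhds zero_ne_one)
  have hne : ∀ᶠ t : I in 𝓝[≠] 0, t ≠ 0 := eventually_mem_nhdsWithin
  let c : I → Ambient n := fun t =>
    (-(Real.sin (Real.pi * t / 2) / 2) • (p.1 - q.1), ‖p.1 - q.1‖ / 2 * Real.cos (Real.pi * t / 2))
  have hc : Continuous c := by fun_prop
  have hcpos : ∀ t : I, t ≠ 1 → 0 < (c t).2 := fun t h1 => by
    have ht1 : (t : ℝ) < 1 := lt_of_le_of_ne t.2.2 fun h => h1 (Subtype.ext h)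
    have : 0 < Real.cos (Real.pi * t / 2) :=
      Real.cos_pos_of_mem_Ioo ⟨by nlinarith [Real.pi_pos, t.2.1], by nlinarith [Real.pi_pos]⟩
    exact mul_pos (by positivity) this
  intro s hs
  rw [Bordered.nhds_ray] at hs
  obtain ⟨t₁, ⟨a, ha, hat⟩, t₂, ⟨b, hb, hbt⟩, hst⟩ := mem_inf_iff.1 (mem_map.1 hs.2)
  have h1 : ∀ᶠ t : I in 𝓝[≠] 0, semicircle p.1 q.1 t ∈ a := by
    refine eventually_nhdsWithin_of_eventually_nhds
      ((continuous_semicircle p.1 q.1).continuousAt ?_)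
    convert ha using 2
    simp only [semicircle, Set.Icc.coe_zero, mul_zero, Real.cos_zero, Real.sin_zero]
    rw [Prod.mk.injEq]
    refine ⟨?_, rfl⟩
    rw [← smul_add, add_add_sub_cancel, ← two_smul ℝ, smul_smul]
    norm_num
  have h2 : ∀ᶠ t : I in 𝓝[≠] 0, ∀ h : 0 < (c t).2, rayOf ⟨c t, h⟩ ∈ b := by
    have hb' : rayOf ⁻¹' b ∈ 𝓝 (⟨c 0, hcpos 0 zero_ne_one⟩ : UpperHalf n) := by
      refine continuous_rayOf.continuousAt ?_
      convert hb using 2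
      refine rayOf_eq_of_smul _ _ (‖p.1 - q.1‖ / 2) ?_
      simp [c]
    rw [nhds_subtype_eq_comap] at hb'
    obtain ⟨w, hw, hwb⟩ := hb'
    filter_upwards [eventually_nhdsWithin_of_eventually_nhds (hc.continuousAt hw)] with t ht h
    exact @hwb ⟨c t, h⟩ ht
  rw [mem_map]
  filter_upwards [hne, hne1, h1, h2] with t ht0 ht1 hta htb
  have hpos := semicircle_height_pos hpq' ht0 ht1
  rw [mem_preimage, alphaPlusFun_of_pos hpos]
  have hmem : (⟨semicircle p.1 q.1 t, hpos⟩ : UpperHalf n) ∈ t₁ ∩ t₂ := by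
    refine ⟨hat hta, hbt ?_⟩
    rw [mem_preimage]
    convert htb (hcpos t ht1) using 1
    refine rayOf_eq_of_smul _ _ (2 * Real.sin (Real.pi * t / 2)) ?_
    have e : Real.pi * (t : ℝ) = 2 * (Real.pi * t / 2) := by ring
    have hcos : Real.cos (Real.pi * t) = 1 - 2 * Real.sin (Real.pi * t / 2) ^ 2 := by
      rw [e, Real.cos_two_mul, ← e]
      nlinarith [Real.sin_sq_add_cos_sq (Real.pi * t / 2)]
    have hsin : Real.sin (Real.pi * t) =
        2 * Real.sin (Real.pi * t / 2) * Real.cos (Real.pi * t / 2) := by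
      rw [e, Real.sin_two_mul, ← e]
    simp only [c, semicircle, hcos, hsin, Prod.smul_mk, Prod.mk_sub_mk, Prod.mk.injEq]
    refine ⟨?_, ?_⟩
    · module
    · simp only [smul_eq_mul]
      ring
  rw [← hst] at hmem
  exact hmem

theorem continuous_alphaPlusFun (p q : S) : Continuous (alphaPlusFun p q) := by
  by_cases hpq : p = q
  · subst hpq
    rw [show alphaPlusFun p p = fun _ => .ray p (verticalRay n) from funext (alphaPlusFun_self p)]
    exact continuous_const
  rw [continuous_iff_continuousAt]
  intro t
  by_cases h0 : t = 0
  · subst h0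
    exact continuousAt_alphaPlusFun_zero hpq
  by_cases h1 : t = 1
  · subst h1
    have h := continuousAt_alphaPlusFun_zero (Ne.symm hpq)
    rw [← unitInterval.symm_one] at h
    have h' := ContinuousAt.comp (x := (1 : I)) h unitInterval.continuous_symm.continuousAt
    convert h' using 1
    funext t
    rw [Function.comp_apply, alphaPlusFun_symm]
  have hpos := semicircle_height_pos (fun h => hpq (Subtype.ext h)) h0 h1
  have hopen : IsOpen {t : I | 0 < (semicircle p.1 q.1 t).2} :=
    isOpen_lt continuous_const (continuous_semicircle _ _).snd
  refine ContinuousOn.continuousAt (s := {t : I | 0 < (semicircle p.1 q.1 t).2}) ?_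
    (hopen.mem_nhds hpos)
  rw [continuousOn_iff_continuous_domRestrict]
  have h : Continuous fun u : {t : I | 0 < (semicircle p.1 q.1 t).2} =>
      (Bordered.inner ⟨semicircle p.1 q.1 u.1, u.2⟩ : Bordered n S) :=
    Bordered.continuous_inner.comp
      (((continuous_semicircle _ _).comp continuous_subtype_val).subtype_mk _)
  convert h using 1
  funext u
  exact alphaPlusFun_of_pos u.2

/-- The path `α⁺_{p,q}` along the semicircle, from the vertical ray at `p` to that at `q`. -/
def alphaPlus (p q : S) :
    Path (Bordered.ray p (verticalRay n) : Bordered n S) (Bordered.ray q (verticalRay n)) where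
  toFun := alphaPlusFun p q
  continuous_toFun := continuous_alphaPlusFun p q
  source' := alphaPlusFun_zero p q
  target' := alphaPlusFun_one p q

/-- The identification of the two copies of each boundary point. -/
inductive Glue (n : ℕ) (S : Set (Hyperplane n)) : Bordered n S ⊕ Bordered n S →
    Bordered n S ⊕ Bordered n S → Prop
  | glue (x : Bordered n S) (hx : x ∈ Bordered.boundary n S) : Glue n S (.inl x) (.inr x)

/-- The Prüfer `n`-manifold: the double of the bordered one, i.e. two copies of it glued along the
boundary, with the quotient topology. -/
abbrev Manifold (n : ℕ) (S : Set (Hyperplane n)) : Type := Quot (Glue n S)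

/-- The inclusion of the first copy of the bordered Prüfer manifold. -/
def upper (x : Bordered n S) : Manifold n S := Quot.mk _ (.inl x)

/-- The inclusion of the second copy of the bordered Prüfer manifold. -/
def lower (x : Bordered n S) : Manifold n S := Quot.mk _ (.inr x)

theorem continuous_upper : Continuous (upper : Bordered n S → Manifold n S) :=
  continuous_quot_mk.comp continuous_inl

theorem continuous_lower : Continuous (lower : Bordered n S → Manifold n S) :=
  continuous_quot_mk.comp continuous_inr

theorem upper_ray_eq_lower_ray (p : S) (r : Ray n) :
    upper (Bordered.ray p r : Bordered n S) = lower (Bordered.ray p r) :=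
  Quot.sound (.glue _ ⟨p, r, rfl⟩)

/-- The vertical ray at `p ∈ S`, as a point of the Prüfer manifold. -/
def verticalPoint (p : S) : Manifold n S := upper (Bordered.ray p (verticalRay n))

/-- The loop `α_{p,q}`: along the semicircle in the first copy from the vertical ray at `p` to that
at `q`, then back along its mirror image in the second copy. -/
def alpha (p q : S) : Path (verticalPoint p) (verticalPoint p) :=
  ((alphaPlus p q).map continuous_upper).trans
    (((alphaPlus p q).symm.map continuous_lower).cast (upper_ray_eq_lower_ray q _)
      (upper_ray_eq_lower_ray p _))

end Pruefer

end

/-! For `p ∈ S` let `U_p` consist of both open half-spaces and the rays at `p`. The slope seen from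
`p` and the signed height identify `U_p` with `ℝ^n` (`isOpenEmbedding_chartAt`). So the `U_p` form a
cover by simply connected open sets, and two distinct ones meet exactly in the upper and the lower
half-space, both path connected. Only this pattern, `TwoPieceCover`, matters for the fundamental
group. Fix a chart `i₀`; each other chart `i` contributes one loop, which goes to the back piece
through `i` and comes back through `i₀`.

These loops generate: a path is cut into finitely many pieces lying in charts, and a change of chart
costs nothing over the front piece and two loops over the back piece
(`tail_trans_symm_tail_mem_range`, `Generated.trans_mk`).

They are free: glue the products of the charts with the discrete free group, trivially over the
front piece and by left translations over the back piece. In the resulting covering the loop of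
chart `i` acts as left multiplication by the generator `i` (`monodromy_loop`), so a word `w` carries
the point with coordinate `1` to the one with coordinate `w` (`freeGroupHom_injective`).

Finally, `α_{p₀,p}` meets the boundary only at the vertical rays at `p₀` and `p`, which makes it the
loop of the chart `p` (`mk_alpha`). -/

section SimplyConnectedPieces

variable {X : Type*} [TopologicalSpace X]

/-! ### Path classes inside simply connected subsets -/

namespace Path.Homotopic.Quotient

/-- The homotopy class of the paths between two points of a simply connected set `U` that stay
inside `U`. -/
noncomputable def within {U : Set X} (hU : IsSimplyConnected U) {x y : X} (hx : x ∈ U)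
    (hy : y ∈ U) : Path.Homotopic.Quotient x y :=
  haveI := hU.simplyConnectedSpace
  (mk (PathConnectedSpace.somePath (⟨x, hx⟩ : U) ⟨y, hy⟩)).map ⟨Subtype.val, continuous_subtype_val⟩

variable {U V : Set X} (hU : IsSimplyConnected U) (hV : IsSimplyConnected V) {x y z : X}

/-- Simple connectedness leaves one class between two points of `U`. Henceforth an identity of
classes only requires knowing which chart each piece of a path stays in. -/
theorem mk_eq_within (γ : Path x y) (hγ : ∀ t, γ t ∈ U) :
    mk γ = within hU (γ.source ▸ hγ 0) (γ.target ▸ hγ 1) := by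
  have := hU.simplyConnectedSpace
  let γ' : Path (⟨x, γ.source ▸ hγ 0⟩ : U) ⟨y, γ.target ▸ hγ 1⟩ :=
    { toFun := fun t => ⟨γ t, hγ t⟩
      continuous_toFun := γ.continuous.subtype_mk _
      source' := Subtype.ext γ.source
      target' := Subtype.ext γ.target }
  have h : mk γ = (mk γ').map ⟨Subtype.val, continuous_subtype_val⟩ := rfl
  rw [h, within, Subsingleton.elim (mk γ')]

theorem exists_mk_eq_within (hx : x ∈ U) (hy : y ∈ U) :
    ∃ γ : Path x y, (∀ t, γ t ∈ U) ∧ mk γ = within hU hx hy := by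
  have := hU.simplyConnectedSpace
  refine ⟨(PathConnectedSpace.somePath (⟨x, hx⟩ : U) ⟨y, hy⟩).map continuous_subtype_val,
    fun t => Subtype.coe_prop _, rfl⟩

theorem symm_trans_eq (p : Path.Homotopic.Quotient x y) (q : Path.Homotopic.Quotient y z) :
    (p.trans q).symm = q.symm.trans p.symm := by
  obtain ⟨p, rfl⟩ := mk_surjective p
  obtain ⟨q, rfl⟩ := mk_surjective q
  rw [← mk_trans, ← mk_symm, Path.trans_symm, mk_trans, mk_symm, mk_symm]

theorem within_self (hx : x ∈ U) : within hU hx hx = refl x :=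
  (mk_eq_within hU (Path.refl x) fun _ => hx).symm

theorem within_trans (hx : x ∈ U) (hy : y ∈ U) (hz : z ∈ U) :
    (within hU hx hy).trans (within hU hy hz) = within hU hx hz := by
  obtain ⟨γ, hγ, h⟩ := exists_mk_eq_within hU hx hy
  obtain ⟨δ, hδ, h'⟩ := exists_mk_eq_within hU hy hz
  rw [← h, ← h', ← mk_trans]
  refine mk_eq_within hU _ fun t => ?_
  have ht : γ.trans δ t ∈ range (γ.trans δ) := mem_range_self t
  rw [Path.trans_range] at ht
  rcases ht with ⟨s, hs⟩ | ⟨s, hs⟩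
  · exact hs ▸ hγ s
  · exact hs ▸ hδ s

theorem within_trans_assoc {w : X} (hx : x ∈ U) (hy : y ∈ U) (hz : z ∈ U)
    (c : Path.Homotopic.Quotient z w) :
    (within hU hx hy).trans ((within hU hy hz).trans c) = (within hU hx hz).trans c := by
  rw [← trans_assoc, within_trans]

/-- A path inside `A` represents both classes, so two charts are interchangeable along a connected
piece of their overlap. -/
theorem within_eq_within {A : Set X} (hA : IsPathConnected A) (hAU : A ⊆ U) (hAV : A ⊆ V)
    (hx : x ∈ A) (hy : y ∈ A) :
    within hU (hAU hx) (hAU hy) = within hV (hAV hx) (hAV hy) := by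
  obtain ⟨γ, hγ⟩ := hA.joinedIn x hx y hy
  rw [← mk_eq_within hU γ fun t => hAU (hγ t), ← mk_eq_within hV γ fun t => hAV (hγ t)]

theorem mk_subpath_trans {a b : X} (γ : Path a b) (r s t : I) :
    (mk (γ.subpath r s)).trans (mk (γ.subpath s t)) = mk (γ.subpath r t) := by
  rw [← mk_trans]
  exact Quotient.sound ⟨Path.Homotopy.subpathTransSubpath γ r s t⟩

theorem mk_subpath_eq_within {a b : X} (γ : Path a b) {s t : I} (hst : s ≤ t)
    (h : ∀ r ∈ Icc s t, γ r ∈ U) :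
    mk (γ.subpath s t) =
      within hU (h s (left_mem_Icc.2 hst)) (h t (right_mem_Icc.2 hst)) := by
  refine mk_eq_within hU _ fun r => ?_
  have hr : γ.subpath s t r ∈ range (γ.subpath s t) := mem_range_self r
  rw [Path.range_subpath_of_le _ _ _ hst] at hr
  obtain ⟨r', hr', e⟩ := hr
  exact e ▸ h r' hr'

/-- A path that stays in `U` until time `s` and in `V` from then on. -/
theorem mk_eq_within_trans_within (γ : Path x y) (s : I) (h : ∀ t ≤ s, γ t ∈ U)
    (h' : ∀ t, s ≤ t → γ t ∈ V) :
    mk γ = (within hU (γ.source ▸ h 0 bot_le) (h s le_rfl)).trans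
      (within hV (h' s le_rfl) (γ.target ▸ h' 1 le_top)) := by
  -- The endpoints become literally `γ 0` and `γ 1`, the endpoints of subpaths.
  obtain ⟨γ, rfl, rfl⟩ := γ
  have e := mk_subpath_trans (⟨γ, rfl, rfl⟩ : Path (γ 0) (γ 1)) 0 s 1
  rw [Path.subpath_zero_one, mk_subpath_eq_within (s := 0) hU _ bot_le fun r hr => h r hr.2,
    mk_subpath_eq_within (t := 1) hV _ le_top fun r hr => h' r hr.1] at e
  exact e.symm

end Path.Homotopic.Quotient

/-! ### Covers whose charts overlap in two common pieces -/

open Path.Homotopic.Quotient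

variable {ι : Type*}

/-- A covering of a space by simply connected open sets, any two of which meet in the same disjoint
union of two path connected open sets. -/
structure TwoPieceCover (X : Type*) [TopologicalSpace X] (ι : Type*) where
  chart : ι → Set X
  front : Set X
  back : Set X
  isOpen_chart : ∀ i, IsOpen (chart i)
  isSimplyConnected_chart : ∀ i, IsSimplyConnected (chart i)
  exists_mem_chart : ∀ x, ∃ i, x ∈ chart i
  isOpen_front : IsOpen front
  isOpen_back : IsOpen back
  isPathConnected_front : IsPathConnected front
  isPathConnected_back : IsPathConnected back
  disjoint : Disjoint front back
  front_subset : ∀ i, front ⊆ chart i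
  back_subset : ∀ i, back ⊆ chart i
  inter_subset : ∀ i j, i ≠ j → chart i ∩ chart j ⊆ front ∪ back

namespace TwoPieceCover

variable (C : TwoPieceCover X ι)

/-- The loop class at `v` that runs in the chart `i₀` to a point `a` of the front piece, then in the
chart `i` to a point `b` of the back piece, and returns to `v` in the chart `i₀`. -/
noncomputable def loop (i₀ i : ι) {v a b : X} (hv : v ∈ C.chart i₀) (ha : a ∈ C.front)
    (hb : b ∈ C.back) : Path.Homotopic.Quotient v v :=
  (within (C.isSimplyConnected_chart i₀) hv (C.front_subset i₀ ha)).trans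
    ((within (C.isSimplyConnected_chart i) (C.front_subset i ha) (C.back_subset i hb)).trans
      (within (C.isSimplyConnected_chart i₀) (C.back_subset i₀ hb) hv))

variable {C} in
-- Moving a transition point within its connected piece inserts a detour in chart `i₀` and the
-- reverse detour in chart `i`; these cancel by `within_eq_within`.
theorem loop_congr (i₀ i : ι) {v a b a' b' : X} (hv : v ∈ C.chart i₀) (ha : a ∈ C.front)
    (hb : b ∈ C.back) (ha' : a' ∈ C.front) (hb' : b' ∈ C.back) :
    C.loop i₀ i hv ha hb = C.loop i₀ i hv ha' hb' := by
  have h₀ := C.isSimplyConnected_chart i₀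
  have hi := C.isSimplyConnected_chart i
  rw [loop, loop, ← within_trans h₀ hv (C.front_subset i₀ ha') (C.front_subset i₀ ha),
    ← within_trans h₀ (C.back_subset i₀ hb) (C.back_subset i₀ hb') hv,
    within_eq_within h₀ hi C.isPathConnected_front (C.front_subset i₀) (C.front_subset i) ha' ha,
    within_eq_within h₀ hi C.isPathConnected_back (C.back_subset i₀) (C.back_subset i) hb hb']
  simp only [trans_assoc, within_trans_assoc]

theorem loop_self (i₀ : ι) {v a b : X} (hv : v ∈ C.chart i₀) (ha : a ∈ C.front)
    (hb : b ∈ C.back) : C.loop i₀ i₀ hv ha hb = refl v := by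
  rw [loop, within_trans, within_trans, within_self]

/-! ### A covering space with prescribed monodromy -/

section Covering

variable {F : Type*} [TopologicalSpace F] [DiscreteTopology F] [Group F] (a : ι → F)

open Classical in
/-- The fibre bundle with discrete fibre `F` whose transition from chart `i` to chart `j` is trivial
on the front piece and the left multiplication by `(a j)⁻¹ * a i` on the back piece. -/
noncomputable def bundleCore : FiberBundleCore ι X F where
  baseSet := C.chart
  isOpen_baseSet := C.isOpen_chart
  indexAt x := (C.exists_mem_chart x).choose
  mem_baseSet_at x := (C.exists_mem_chart x).choose_spec
  coordChange i j x g := if x ∈ C.back then (a j)⁻¹ * a i * g else g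
  coordChange_self i x _ g := by simp
  continuousOn_coordChange i j := by
    by_cases hij : i = j
    · subst hij
      simpa using continuousOn_snd
    -- Distinct charts meet only in the two open pieces, and over each piece the transition does not
    -- depend on the base point.
    refine ContinuousOn.mono (s := (C.front ∪ C.back) ×ˢ univ) ?_
      (prod_mono_left (C.inter_subset i j hij))
    rw [union_prod]
    refine ContinuousOn.union_of_isOpen ?_ ?_ (C.isOpen_front.prod isOpen_univ)
      (C.isOpen_back.prod isOpen_univ)
    · refine continuousOn_snd.congr fun p hp => ?_
      rw [if_neg (disjoint_left.1 C.disjoint hp.1)]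
    · have h : Continuous fun g : F => (a j)⁻¹ * a i * g := continuous_of_discreteTopology
      refine (h.comp continuous_snd).continuousOn.congr fun p hp => ?_
      rw [if_pos hp.1]
      rfl
  -- Whether `x` lies in the back piece does not depend on the charts, so the factors simply
  -- telescope.
  coordChange_comp i j k x _ g := by
    split_ifs
    · group
    · rfl

theorem isCoveringMap_bundleCore : IsCoveringMap (C.bundleCore a).proj :=
  FiberBundle.isCoveringMap (F := F) (E := (C.bundleCore a).Fiber)

/-- The point of the fibre over `x` with the coordinate `g` in the chart `i`. -/
noncomputable def fibrePoint (i : ι) (x : X) (g : F) : (C.bundleCore a).proj ⁻¹' {x} :=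
  ⟨⟨x, (C.bundleCore a).coordChange i ((C.bundleCore a).indexAt x) x g⟩, rfl⟩

theorem fibrePoint_coordChange {i j : ι} {x : X} (hi : x ∈ C.chart i) (hj : x ∈ C.chart j) (g : F) :
    C.fibrePoint a j x ((C.bundleCore a).coordChange i j x g) = C.fibrePoint a i x g := by
  refine Subtype.ext ?_
  rw [fibrePoint, fibrePoint, (C.bundleCore a).coordChange_comp i j _ x
    ⟨⟨hi, hj⟩, (C.bundleCore a).mem_baseSet_at x⟩]

theorem fibrePoint_front {i j : ι} {x : X} (hx : x ∈ C.front) (g : F) :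
    C.fibrePoint a i x g = C.fibrePoint a j x g := by
  rw [← C.fibrePoint_coordChange a (C.front_subset i hx) (C.front_subset j hx) g]
  congr 1
  exact if_neg (disjoint_left.1 C.disjoint hx)

theorem fibrePoint_back {i j : ι} {x : X} (hx : x ∈ C.back) (g : F) :
    C.fibrePoint a i x g = C.fibrePoint a j x ((a j)⁻¹ * a i * g) := by
  rw [← C.fibrePoint_coordChange a (C.back_subset i hx) (C.back_subset j hx) g]
  congr 1
  exact if_pos hx

theorem fibrePoint_injective {i : ι} {x : X} (hx : x ∈ C.chart i) :
    Function.Injective (C.fibrePoint a i x) := by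
  intro g h e
  have e' : (C.bundleCore a).coordChange i ((C.bundleCore a).indexAt x) x g =
      (C.bundleCore a).coordChange i ((C.bundleCore a).indexAt x) x h := by
    injection congrArg Subtype.val e
  have := congrArg ((C.bundleCore a).coordChange ((C.bundleCore a).indexAt x) i x) e'
  have hm : x ∈ C.chart i ∩ C.chart ((C.bundleCore a).indexAt x) ∩ C.chart i :=
    ⟨⟨hx, (C.bundleCore a).mem_baseSet_at x⟩, hx⟩
  rwa [(C.bundleCore a).coordChange_comp _ _ _ x hm, (C.bundleCore a).coordChange_comp _ _ _ x hm,
    (C.bundleCore a).coordChange_self _ x hx, (C.bundleCore a).coordChange_self _ x hx] at this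

/-- Over a path in chart `i`, keeping the coordinate `g` constant gives a lift, continuous by the
local trivialization; uniqueness of lifts identifies its end with the monodromy. -/
theorem monodromy_within {i : ι} {x y : X} (hx : x ∈ C.chart i) (hy : y ∈ C.chart i) (g : F) :
    (C.isCoveringMap_bundleCore a).monodromy (within (C.isSimplyConnected_chart i) hx hy)
      (C.fibrePoint a i x g) = C.fibrePoint a i y g := by
  obtain ⟨γ, hγ, e⟩ := exists_mk_eq_within (C.isSimplyConnected_chart i) hx hy
  rw [← e]
  have hc : Continuous fun t => (C.fibrePoint a i (γ t) g).1 := by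
    have h := ((C.bundleCore a).localTriv i).continuousOn_invFun
    exact h.comp_continuous (γ.continuous.prodMk (continuous_const (y := g)))
      fun t => ⟨hγ t, mem_univ _⟩
  let Γ : Path (C.fibrePoint a i x g).1 (C.fibrePoint a i y g).1 :=
    { toFun := fun t => (C.fibrePoint a i (γ t) g).1
      continuous_toFun := hc
      source' := by rw [γ.source]
      target' := by rw [γ.target] }
  exact (C.isCoveringMap_bundleCore a).monodromy_eq_of_map_eq (.mk Γ)
    (congrArg Path.Homotopic.Quotient.mk (Path.ext rfl))

/-- The coordinate is unchanged by passing from `i₀` to `i` over the front piece; only the passage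
back to `i₀` over the back piece contributes a factor. -/
theorem monodromy_loop {i₀ i : ι} {v x y : X} (hv : v ∈ C.chart i₀) (hx : x ∈ C.front)
    (hy : y ∈ C.back) (g : F) :
    (C.isCoveringMap_bundleCore a).monodromy (C.loop i₀ i hv hx hy) (C.fibrePoint a i₀ v g) =
      C.fibrePoint a i₀ v ((a i₀)⁻¹ * a i * g) := by
  rw [loop, IsCoveringMap.monodromy_trans_apply, IsCoveringMap.monodromy_trans_apply,
    monodromy_within, C.fibrePoint_front a (i := i₀) (j := i) hx, monodromy_within,
    C.fibrePoint_back a (i := i) (j := i₀) hy, monodromy_within]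

end Covering

end TwoPieceCover

end SimplyConnectedPieces

/-! ### Freeness of the fundamental group -/

section FreeFundamentalGroup

open Path.Homotopic.Quotient

variable {X : Type*} [TopologicalSpace X] {ι : Type*}

namespace TwoPieceCover

variable (C : TwoPieceCover X ι) {i₀ : ι} {v a b : X} (hv : v ∈ C.chart i₀) (ha : a ∈ C.front)
  (hb : b ∈ C.back)

/-- The homomorphism from the free group that maps the generators to the loops of the cover. -/
noncomputable def freeGroupHom : FreeGroup {i // i ≠ i₀} →* FundamentalGroup X v :=
  FreeGroup.lift fun i => FundamentalGroup.fromPath (C.loop i₀ i hv ha hb)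

theorem freeGroupHom_of (i : {i // i ≠ i₀}) : C.freeGroupHom hv ha hb (FreeGroup.of i) =
    FundamentalGroup.fromPath (C.loop i₀ i hv ha hb) :=
  FreeGroup.lift_apply_of

/-- The free group itself serves as the fibre, so that monodromy becomes its left regular action,
which is faithful. -/
theorem freeGroupHom_injective : Function.Injective (C.freeGroupHom hv ha hb) := by
  classical
  let _ : TopologicalSpace (FreeGroup {i // i ≠ i₀}) := ⊥
  have : DiscreteTopology (FreeGroup {i // i ≠ i₀}) := ⟨rfl⟩
  -- The value `1` at `i₀` turns the factor `(s i₀)⁻¹ * s i` of `monodromy_loop` into the generator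
  -- `i`.
  let s : ι → FreeGroup {i // i ≠ i₀} := fun i => if h : i ≠ i₀ then FreeGroup.of ⟨i, h⟩ else 1
  let M := (C.isCoveringMap_bundleCore s).monodromyPerm v
  have key : ∀ w g, M (C.freeGroupHom hv ha hb w) (C.fibrePoint s i₀ v g) =
      C.fibrePoint s i₀ v (w * g) := by
    intro w
    induction w using FreeGroup.induction_on with
    | C1 => intro g; rw [map_one, map_one, one_mul]; rfl
    | of i =>
      intro g
      rw [freeGroupHom_of]
      refine (C.monodromy_loop s hv ha hb g).trans ?_
      have h0 : s i₀ = 1 := dif_neg (not_not.2 rfl)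
      have hi : s i = FreeGroup.of i := dif_pos i.2
      rw [h0, hi, inv_one, one_mul]
    | inv_of i ih =>
      intro g
      rw [map_inv, map_inv, Equiv.Perm.inv_eq_iff_eq, ih, mul_inv_cancel_left]
    | mul x y hx hy =>
      intro g
      rw [map_mul, map_mul, Equiv.Perm.mul_apply, hy, hx, mul_assoc]
  rw [injective_iff_map_eq_one]
  intro w hw
  have h := key w 1
  rw [hw, map_one, Equiv.Perm.one_apply] at h
  simpa using (C.fibrePoint_injective s hv h).symm

/-! ### Generation by the loops of the cover -/

/-- The class from `v` to a point `x` of the chart `i` that passes from the chart `i₀` to the chart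
`i` in the front piece. -/
noncomputable def tail (i : ι) {x : X} (hx : x ∈ C.chart i) : Path.Homotopic.Quotient v x :=
  (within (C.isSimplyConnected_chart i₀) hv (C.front_subset i₀ ha)).trans
    (within (C.isSimplyConnected_chart i) (C.front_subset i ha) hx)

theorem tail_self : C.tail hv ha i₀ hv = refl v := by
  rw [tail, within_trans, within_self]

theorem loop_mem_range (i : ι) :
    FundamentalGroup.fromPath (C.loop i₀ i hv ha hb) ∈ (C.freeGroupHom hv ha hb).range := by
  by_cases h : i = i₀
  · subst h
    rw [loop_self]
    exact one_mem _
  · exact ⟨FreeGroup.of ⟨i, h⟩, C.freeGroupHom_of hv ha hb ⟨i, h⟩⟩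

/-- This is the cost of changing charts at `x`: for distinct charts the tails agree if `x` is in the
front piece, and differ by the loops of `i` and `j` if it is in the back piece. -/
theorem tail_trans_symm_tail_mem_range {i j : ι} {x : X} (hi : x ∈ C.chart i) (hj : x ∈ C.chart j) :
    FundamentalGroup.fromPath ((C.tail hv ha i hi).trans (C.tail hv ha j hj).symm) ∈
      (C.freeGroupHom hv ha hb).range := by
  have h₀ := C.isSimplyConnected_chart i₀
  have hCi := C.isSimplyConnected_chart i
  have hCj := C.isSimplyConnected_chart j
  by_cases hij : i = j
  · subst hij
    rw [trans_symm]
    exact one_mem _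
  rcases C.inter_subset i j hij ⟨hi, hj⟩ with hx | hx
  · have e : C.tail hv ha i hi = C.tail hv ha j hj := by
      rw [tail, tail, within_eq_within hCi hCj C.isPathConnected_front (C.front_subset i)
        (C.front_subset j) ha hx]
    rw [e, trans_symm]
    exact one_mem _
  -- With `x` as transition point in the back piece, each tail is a loop followed by a path in `i₀`
  -- common to all `k`.
  · have e : ∀ k (hk : x ∈ C.chart k), C.tail hv ha k hk = (C.loop i₀ k hv ha hx).trans
        (within h₀ hv (C.back_subset i₀ hx)) := by
      intro k hk
      rw [tail, loop, trans_assoc, trans_assoc, within_trans, within_self, trans_refl]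
    have e' : (C.tail hv ha i hi).trans (C.tail hv ha j hj).symm =
        (C.loop i₀ i hv ha hb).trans (C.loop i₀ j hv ha hb).symm := by
      rw [e i hi, e j hj, loop_congr i₀ i hv ha hx ha hb, loop_congr i₀ j hv ha hx ha hb]
      generalize C.loop i₀ i hv ha hb = p
      generalize C.loop i₀ j hv ha hb = q
      generalize within h₀ hv _ = r
      rw [symm_trans_eq, trans_assoc, ← trans_assoc r, trans_symm, refl_trans]
    rw [e']
    -- In a product in `FundamentalGroup` the right factor is traversed first.
    exact mul_mem (inv_mem (C.loop_mem_range hv ha hb j)) (C.loop_mem_range hv ha hb i)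

/-- A class from `v` to `x` is generated by the loops of the cover if it becomes so after returning
from `x` to `v` inside a chart. -/
def Generated {x : X} (c : Path.Homotopic.Quotient v x) : Prop :=
  ∀ i (hi : x ∈ C.chart i), FundamentalGroup.fromPath (c.trans (C.tail hv ha i hi).symm) ∈
    (C.freeGroupHom hv ha hb).range

variable {C hv ha hb} in
-- Returning through another chart multiplies by an element already known to lie in the range, so
-- one chart suffices.
theorem generated_of_mem {i : ι} {x : X} {c : Path.Homotopic.Quotient v x} (hi : x ∈ C.chart i)
    (h : FundamentalGroup.fromPath (c.trans (C.tail hv ha i hi).symm) ∈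
      (C.freeGroupHom hv ha hb).range) : C.Generated hv ha hb c := by
  intro j hj
  have e : c.trans (C.tail hv ha j hj).symm = (c.trans (C.tail hv ha i hi).symm).trans
      ((C.tail hv ha i hi).trans (C.tail hv ha j hj).symm) := by
    rw [trans_assoc, ← trans_assoc (C.tail hv ha i hi).symm, symm_trans, refl_trans]
  rw [e]
  exact mul_mem (C.tail_trans_symm_tail_mem_range hv ha hb hi hj) h

variable {C hv ha hb} in
-- The tail to `y` is the tail to `x` followed by the new piece, so the piece cancels on returning
-- through the same chart.
theorem Generated.trans_within {i : ι} {x y : X} {c : Path.Homotopic.Quotient v x}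
    (hc : C.Generated hv ha hb c) (hx : x ∈ C.chart i) (hy : y ∈ C.chart i) :
    C.Generated hv ha hb (c.trans (within (C.isSimplyConnected_chart i) hx hy)) := by
  refine generated_of_mem hy ?_
  have e : C.tail hv ha i hy = (C.tail hv ha i hx).trans
      (within (C.isSimplyConnected_chart i) hx hy) := by
    rw [tail, tail, trans_assoc, within_trans]
  have e' : (c.trans (within (C.isSimplyConnected_chart i) hx hy)).trans
      (C.tail hv ha i hy).symm = c.trans (C.tail hv ha i hx).symm := by
    rw [e, symm_trans_eq, trans_assoc, ← trans_assoc (within _ hx hy), trans_symm, refl_trans]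
  rw [e']
  exact hc i hx

variable {C hv ha hb} in
-- By compactness of the interval the path has a finite subdivision into pieces lying in charts;
-- these are appended one at a time.
theorem Generated.trans_mk {x y : X} {c : Path.Homotopic.Quotient v x}
    (hc : C.Generated hv ha hb c) (γ : Path x y) : C.Generated hv ha hb (c.trans (.mk γ)) := by
  obtain ⟨γ, rfl, rfl⟩ := γ
  let γ' : Path (γ 0) (γ 1) := ⟨γ, rfl, rfl⟩
  obtain ⟨t, ht0, htm, ⟨N, hN⟩, ht⟩ := exists_monotone_Icc_subset_open_cover_unitInterval
    (c := fun i => γ ⁻¹' C.chart i) (fun i => (C.isOpen_chart i).preimage γ.continuous)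
    fun s _ => mem_iUnion.2 (C.exists_mem_chart (γ s))
  have key : ∀ n, C.Generated hv ha hb (c.trans (.mk (γ'.subpath 0 (t n)))) := by
    intro n
    induction n with
    | zero =>
      rw [ht0, Path.subpath_self]
      exact (congrArg (C.Generated hv ha hb) (trans_refl c)).mpr hc
    | succ n ih =>
      obtain ⟨i, hi⟩ := ht n
      rw [← mk_subpath_trans γ' 0 (t n), ← trans_assoc, mk_subpath_eq_within
        (C.isSimplyConnected_chart i) γ' (htm n.le_succ) fun r hr => hi hr]
      exact ih.trans_within _ _
  have h := key N
  rw [hN N le_rfl, Path.subpath_zero_one] at h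
  exact h

/-- A loop at `v` extends the constant class and is therefore generated; returning in `i₀` adds
nothing, since that tail is trivial. -/
theorem freeGroupHom_surjective : Function.Surjective (C.freeGroupHom hv ha hb) := by
  intro p
  have h1 : C.Generated hv ha hb (refl v) := by
    refine generated_of_mem hv ?_
    rw [tail_self, trans_symm]
    exact one_mem _
  obtain ⟨γ, rfl⟩ := mk_surjective p
  have h := h1.trans_mk γ i₀ hv
  rw [refl_trans, C.tail_self hv ha] at h
  have e : (Path.Homotopic.Quotient.mk γ).trans (refl v).symm = .mk γ := by
    rw [← mk_refl, ← mk_symm, Path.refl_symm, mk_refl, trans_refl]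
  rwa [e] at h

/-- The fundamental group is free on the loops of the cover. -/
theorem exists_freeGroup_mulEquiv : ∃ e : FreeGroup {i // i ≠ i₀} ≃* FundamentalGroup X v,
    ∀ i, e (FreeGroup.of i) = FundamentalGroup.fromPath (C.loop i₀ i hv ha hb) :=
  ⟨MulEquiv.ofBijective _ ⟨C.freeGroupHom_injective hv ha hb, C.freeGroupHom_surjective hv ha hb⟩,
    C.freeGroupHom_of hv ha hb⟩

end TwoPieceCover

end FreeFundamentalGroup

/-! ### Slope and height coordinates on the bordered manifold -/

namespace Pruefer

variable {n : ℕ} {S : Set (Hyperplane n)}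

/-- The hyperplane coordinate of the direction vector of a ray that has height `1`. -/
noncomputable def slope (r : Ray n) : Hyperplane n :=
  Projectivization.lift (fun v : {v : Ambient n // v ≠ 0} => v.1.2⁻¹ • v.1.1) (by
    rintro ⟨a, ha⟩ ⟨b, hb⟩ t h
    simp only at h
    have ht : t ≠ 0 := fun h0 => ha (by rw [h, h0, zero_smul])
    simp only [h, Prod.smul_snd, Prod.smul_fst, smul_smul, smul_eq_mul]
    congr 1
    rw [mul_inv, mul_right_comm, inv_mul_cancel₀ ht, one_mul]) r.1

theorem slope_rayOf (v : UpperHalf n) : slope (rayOf v) = v.1.2⁻¹ • v.1.1 := rfl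

/-- A line not contained in the hyperplane has a direction vector of height `1`. -/
theorem rayOf_slope (r : Ray n) : rayOf ⟨(slope r, 1), one_pos⟩ = r := by
  obtain ⟨l, hl⟩ := r
  induction l using Projectivization.ind with
  | h v hv =>
    have h2 : v.2 ≠ 0 := by
      rwa [Projectivization.submodule_mk, Submodule.span_singleton_le_iff_mem,
        LinearMap.mem_ker] at hl
    refine Subtype.ext ((Projectivization.mk_eq_mk_iff' ℝ _ _ _ _).2 ⟨v.2⁻¹, ?_⟩)
    exact Prod.ext rfl (inv_mul_cancel₀ h2)

/-- The formula on vectors is continuous only off the hyperplane. Hence the preimage of `W` is shown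
to be the trace of an open set of the whole projective space. -/
theorem continuous_slope : Continuous (slope : Ray n → Hyperplane n) := by
  refine ⟨fun W hW => ?_⟩
  let f : {v : Ambient n // v ≠ 0} → Hyperplane n := fun v => v.1.2⁻¹ • v.1.1
  have hO : IsOpen {v : {v : Ambient n // v ≠ 0} | v.1.2 ≠ 0} :=
    isOpen_ne.preimage (continuous_snd.comp continuous_subtype_val)
  have hf : ContinuousOn f {v | v.1.2 ≠ 0} :=
    ((continuous_snd.comp continuous_subtype_val).continuousOn.inv₀ fun _ h => h).smul
      (continuous_fst.comp continuous_subtype_val).continuousOn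
  have hO' := hf.isOpen_inter_preimage hO hW
  let q : {v : Ambient n // v ≠ 0} → ℙ ℝ (Ambient n) := fun v => Projectivization.mk ℝ v.1 v.2
  have hq : IsOpen (q '' ({v | v.1.2 ≠ 0} ∩ f ⁻¹' W)) := by
    refine (isQuotientMap_quotient_mk' (s := projectivizationSetoid ℝ (Ambient n)))
      |>.isOpen_preimage.1 ?_
    -- The set of vectors is saturated: neither of its conditions changes under rescaling.
    convert hO' using 1
    ext v
    constructor
    · rintro ⟨w, ⟨hw, hwW⟩, h⟩
      obtain ⟨c, hc⟩ := (Projectivization.mk_eq_mk_iff' ℝ _ _ w.2 v.2).1 h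
      have h2 : w.1.2 = c * v.1.2 := by rw [← hc]; rfl
      have h1 : w.1.1 = c • v.1.1 := by rw [← hc]; rfl
      have hc0 : c ≠ 0 := fun h => hw (by rw [h2, h, zero_mul])
      have hv : v.1.2 ≠ 0 := fun h => hw (by rw [h2, h, mul_zero])
      refine ⟨hv, ?_⟩
      have e : f v = f w := by
        simp only [f, h1, h2, smul_smul]
        congr 1
        field_simp
      rw [mem_preimage, e]
      exact hwW
    · exact fun h => ⟨v, h, rfl⟩
  convert hq.preimage (continuous_subtype_val (p := fun l : ℙ ℝ (Ambient n) =>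
    ¬ l.submodule ≤ LinearMap.ker (LinearMap.snd ℝ (Hyperplane n) ℝ))) using 1
  ext r
  constructor
  · intro hr
    rw [← rayOf_slope r]
    refine ⟨⟨(slope r, 1), fun h => one_ne_zero (congrArg Prod.snd h)⟩, ⟨one_ne_zero, ?_⟩, rfl⟩
    simpa [f] using hr
  · rintro ⟨v, ⟨hv, hvW⟩, h⟩
    have e : slope r = f v := by
      unfold slope
      rw [← h]
      rfl
    rw [mem_preimage, e]
    exact hvW

theorem rayThrough_eq (p : Hyperplane n) (x : UpperHalf n) :
    rayThrough p x = rayOf ⟨(x.1.2⁻¹ • (x.1.1 - p), 1), one_pos⟩ := by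
  rw [← rayOf_slope (rayThrough p x), rayThrough]
  simp [slope_rayOf]

theorem tendsto_slope_tangential (p : Hyperplane n) (r : Ray n) :
    Tendsto (fun x : UpperHalf n => x.1.2⁻¹ • (x.1.1 - p)) (tangential p r) (𝓝 (slope r)) := by
  have h : Tendsto (rayThrough p) (tangential p r) (𝓝 r) := tendsto_comap.mono_left inf_le_right
  refine ((continuous_slope.tendsto r).comp h).congr fun x => ?_
  simp [rayThrough, slope_rayOf]

theorem tendsto_height_tangential (p : Hyperplane n) (r : Ray n) :
    Tendsto (fun x : UpperHalf n => x.1.2) (tangential p r) (𝓝 0) := by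
  have h : Tendsto (Subtype.val : UpperHalf n → Ambient n) (tangential p r) (𝓝 (p, 0)) :=
    tendsto_comap.mono_left inf_le_left
  exact (continuous_snd.tendsto (p, (0 : ℝ))).comp h

namespace Bordered

/-- The last coordinate, which vanishes on the boundary. -/
def height : Bordered n S → ℝ
  | inner x => x.1.2
  | ray _ _ => 0

/-- The point at which a boundary point is based. -/
def foot : Bordered n S → Option S
  | inner _ => none
  | ray p _ => some p

/-- The slope of the line from `p` to a given point. -/
noncomputable def slopeFrom (p : S) : Bordered n S → Hyperplane n
  | inner x => x.1.2⁻¹ • (x.1.1 - p.1)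
  | ray _ r => slope r

theorem continuous_height : Continuous (height : Bordered n S → ℝ) := by
  rw [continuous_iff_continuousAt]
  rintro (x | ⟨p, r⟩)
  · rw [ContinuousAt, nhds_inner, tendsto_map'_iff]
    exact (continuous_snd.comp continuous_subtype_val).continuousAt
  · rw [ContinuousAt, nhds_ray, tendsto_sup, tendsto_map'_iff, tendsto_map'_iff]
    exact ⟨tendsto_const_nhds, tendsto_height_tangential p.1 r⟩

/-- The bordered manifold with all boundary components but the one at `p` removed has the slope
and the height as coordinates. -/
theorem isOpen_coordinates (p : S) {U : Set (Ambient n)} (hU : IsOpen U) :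
    IsOpen {x : Bordered n S |
      (x.foot = none ∨ x.foot = some p) ∧ (slopeFrom p x, height x) ∈ U} := by
  refine isOpen_iff.2 ⟨?_, ?_⟩
  · have hc : Continuous fun x : UpperHalf n => ((x.1.2⁻¹ • (x.1.1 - p.1), x.1.2) : Ambient n) := by
      have h2 : Continuous fun x : UpperHalf n => x.1.2 :=
        continuous_snd.comp continuous_subtype_val
      exact ((h2.inv₀ fun x => x.2.ne').smul ((continuous_fst.comp continuous_subtype_val).sub
        continuous_const)).prodMk h2
    convert hU.preimage hc using 1
    ext x
    exact ⟨fun h => h.2, fun h => ⟨Or.inl rfl, h⟩⟩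
  · rintro q r ⟨hq | hq, hr⟩
    · cases hq
    · obtain rfl : q = p := Option.some.inj hq
      constructor
      · have hc : Continuous fun r : Ray n => ((slope r, 0) : Ambient n) :=
          continuous_slope.prodMk continuous_const
        exact mem_of_superset (hc.continuousAt.preimage_mem_nhds (hU.mem_nhds hr))
          fun r' h => ⟨Or.inr rfl, h⟩
      · exact mem_of_superset (((tendsto_slope_tangential q.1 r).prodMk_nhds
          (tendsto_height_tangential q.1 r)) (hU.mem_nhds hr)) fun x h => ⟨Or.inl rfl, h⟩

open Classical in
/-- The point with the given slope from `p` whose height is the absolute value of the given one. -/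
noncomputable def ofCoordinates (p : S) (y : Ambient n) : Bordered n S :=
  if h : 0 < |y.2| then inner ⟨(p.1 + |y.2| • y.1, |y.2|), h⟩
  else ray p (rayOf ⟨(y.1, 1), one_pos⟩)

theorem height_ofCoordinates (p : S) (y : Ambient n) : (ofCoordinates p y).height = |y.2| := by
  unfold ofCoordinates
  split_ifs with h
  · rfl
  · exact (le_antisymm (not_lt.1 h) (abs_nonneg _)).symm

theorem slopeFrom_ofCoordinates (p : S) (y : Ambient n) :
    slopeFrom p (ofCoordinates p y) = y.1 := by
  unfold ofCoordinates
  split_ifs with h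
  · simp [slopeFrom, smul_smul, inv_mul_cancel₀ h.ne']
  · simp [slopeFrom, slope_rayOf]

theorem foot_ofCoordinates (p : S) (y : Ambient n) :
    (ofCoordinates p y).foot = none ∨ (ofCoordinates p y).foot = some p := by
  unfold ofCoordinates
  split_ifs
  · exact Or.inl rfl
  · exact Or.inr rfl

theorem ofCoordinates_eq (p : S) {x : Bordered n S} (hx : x.foot = none ∨ x.foot = some p)
    {y : Ambient n} (h₁ : y.1 = slopeFrom p x) (h₂ : |y.2| = height x) : ofCoordinates p y = x := by
  rcases x with x | ⟨q, r⟩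
  · have h : 0 < |y.2| := h₂ ▸ x.2
    rw [ofCoordinates, dif_pos h]
    congr 1
    refine Subtype.ext (Prod.ext ?_ h₂)
    change p.1 + |y.2| • y.1 = x.1.1
    rw [h₁, h₂]
    simp only [height, slopeFrom]
    rw [smul_smul, mul_inv_cancel₀ x.2.ne', one_smul, add_sub_cancel]
  · rcases hx with hx | hx
    · cases hx
    · obtain rfl : q = p := Option.some.inj hx
      have h : ¬ 0 < |y.2| := h₂ ▸ lt_irrefl _
      rw [ofCoordinates, dif_neg h]
      congr 1
      rw [← rayOf_slope r]
      simp only [h₁, slopeFrom]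

/-- At height zero both conditions of tangential convergence hold: `p + |z.2| • z.1` tends to `p`,
and its ray from `p` has slope exactly `z.1`. -/
theorem continuous_ofCoordinates (p : S) : Continuous (ofCoordinates p) := by
  rw [continuous_iff_continuousAt]
  intro y
  have hg : Continuous fun z : Ambient n => ((p.1 + |z.2| • z.1, |z.2|) : Ambient n) := by fun_prop
  by_cases hy : 0 < |y.2|
  · have hO : IsOpen {z : Ambient n | 0 < |z.2|} := isOpen_lt continuous_const (by fun_prop)
    refine ContinuousOn.continuousAt (s := {z : Ambient n | 0 < |z.2|}) ?_ (hO.mem_nhds hy)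
    rw [continuousOn_iff_continuous_domRestrict]
    convert (continuous_inner (S := S)).comp
      ((hg.comp continuous_subtype_val).subtype_mk fun z : {z : Ambient n | 0 < |z.2|} => z.2)
      using 1
    funext z
    exact dif_pos z.2
  · have hr : Continuous fun z : Ambient n => rayOf (n := n) ⟨(z.1, 1), one_pos⟩ :=
      continuous_rayOf.comp ((continuous_fst.prodMk continuous_const).subtype_mk _)
    have e : ofCoordinates p y = ray p (rayOf ⟨(y.1, 1), one_pos⟩) := dif_neg hy
    intro s hs
    rw [e, nhds_ray] at hs
    obtain ⟨t₁, ⟨a, ha, hat⟩, t₂, ⟨b, hb, hbt⟩, hst⟩ := mem_inf_iff.1 (mem_map.1 hs.2)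
    have hy0 : |y.2| = 0 := le_antisymm (not_lt.1 hy) (abs_nonneg _)
    have h1 : ∀ᶠ z : Ambient n in 𝓝 y, ((p.1 + |z.2| • z.1, |z.2|) : Ambient n) ∈ a := by
      refine hg.continuousAt ?_
      simpa [hy0] using ha
    have h2 : ∀ᶠ z : Ambient n in 𝓝 y, rayOf (n := n) ⟨(z.1, 1), one_pos⟩ ∈ b :=
      hr.continuousAt hb
    have h3 : ∀ᶠ z : Ambient n in 𝓝 y, ray p (rayOf (n := n) ⟨(z.1, 1), one_pos⟩) ∈ s :=
      hr.continuousAt hs.1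
    rw [mem_map]
    filter_upwards [h1, h2, h3] with z hz1 hz2 hz3
    rw [mem_preimage, ofCoordinates]
    split_ifs with h
    · have hmem : (⟨(p.1 + |z.2| • z.1, |z.2|), h⟩ : UpperHalf n) ∈ t₁ ∩ t₂ := by
        refine ⟨hat hz1, hbt ?_⟩
        rw [mem_preimage, rayThrough_eq]
        simpa [smul_smul, inv_mul_cancel₀ h.ne'] using hz2
      rw [← hst] at hmem
      exact hmem
    · exact hz3

end Bordered

end Pruefer

/-! ### Charts of the double and the resulting cover -/

namespace Pruefer

variable {n : ℕ} {S : Set (Hyperplane n)}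

open Bordered

theorem manifold_cases (x : Manifold n S) : (∃ y, x = upper (inner y)) ∨
    (∃ y, x = lower (inner y)) ∨ ∃ p r, x = upper (ray p r) := by
  obtain ⟨x | x⟩ := x
  · rcases x with y | ⟨p, r⟩
    · exact Or.inl ⟨y, rfl⟩
    · exact Or.inr (Or.inr ⟨p, r, rfl⟩)
  · rcases x with y | ⟨p, r⟩
    · exact Or.inr (Or.inl ⟨y, rfl⟩)
    · exact Or.inr (Or.inr ⟨p, r, (upper_ray_eq_lower_ray p r).symm⟩)

/-- The last coordinate on the first copy and its negative on the second one. -/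
def signedHeight : Manifold n S → ℝ :=
  Quot.lift (Sum.elim height fun x => -height x) (by
    rintro _ _ ⟨_, p, r, rfl⟩
    exact neg_zero.symm)

/-- The point at which a boundary point is based. -/
def footOf : Manifold n S → Option S :=
  Quot.lift (Sum.elim foot foot) (by
    rintro _ _ ⟨_, p, r, rfl⟩
    rfl)

/-- The slope of the line from `p` to a given point of either copy. -/
noncomputable def slopeOf (p : S) : Manifold n S → Hyperplane n :=
  Quot.lift (Sum.elim (slopeFrom p) (slopeFrom p)) (by
    rintro _ _ ⟨_, q, r, rfl⟩
    rfl)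

theorem continuous_signedHeight : Continuous (signedHeight : Manifold n S → ℝ) :=
  continuous_quot_lift _ (continuous_height.sumElim continuous_height.neg)

theorem isOpen_manifold_iff {U : Set (Manifold n S)} :
    IsOpen U ↔ IsOpen (upper ⁻¹' U) ∧ IsOpen (lower ⁻¹' U) := by
  rw [← isQuotientMap_quot_mk.isOpen_preimage, isOpen_sum_iff]
  rfl

/-- The chart of the Prüfer manifold around the boundary component at `p`. -/
noncomputable def chartAt (p : S) (y : Ambient n) : Manifold n S :=
  if 0 ≤ y.2 then upper (ofCoordinates p y) else lower (ofCoordinates p y)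

/-- At height zero both formulas give the same ray, whose two copies are glued. -/
theorem continuous_chartAt (p : S) : Continuous (chartAt p) := by
  refine Continuous.if_le (continuous_upper.comp (continuous_ofCoordinates p))
    (continuous_lower.comp (continuous_ofCoordinates p)) continuous_const continuous_snd ?_
  intro y hy
  have h : ¬ 0 < |y.2| := by rw [← hy, abs_zero]; exact lt_irrefl _
  simp only [ofCoordinates, dif_neg h]
  exact upper_ray_eq_lower_ray p _

theorem signedHeight_chartAt (p : S) (y : Ambient n) : signedHeight (chartAt p y) = y.2 := by
  unfold chartAt
  split_ifs with h
  · exact (height_ofCoordinates p y).trans (abs_of_nonneg h)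
  · exact (congrArg Neg.neg (height_ofCoordinates p y)).trans
      (by rw [abs_of_neg (not_le.1 h), neg_neg])

theorem slopeOf_chartAt (p : S) (y : Ambient n) : slopeOf p (chartAt p y) = y.1 := by
  unfold chartAt
  split_ifs
  · exact slopeFrom_ofCoordinates p y
  · exact slopeFrom_ofCoordinates p y

theorem footOf_chartAt (p : S) (y : Ambient n) :
    footOf (chartAt p y) = none ∨ footOf (chartAt p y) = some p := by
  unfold chartAt
  split_ifs
  · exact foot_ofCoordinates p y
  · exact foot_ofCoordinates p y

theorem chartAt_coordinates (p : S) {x : Manifold n S} (hx : footOf x = none ∨ footOf x = some p) :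
    chartAt p (slopeOf p x, signedHeight x) = x := by
  rcases manifold_cases x with ⟨y, rfl⟩ | ⟨y, rfl⟩ | ⟨q, r, rfl⟩
  · exact (if_pos y.2.le).trans (congrArg upper
      (ofCoordinates_eq p (x := inner y) hx rfl (abs_of_pos y.2)))
  · exact (if_neg (neg_neg_of_pos y.2).not_ge).trans (congrArg lower
      (ofCoordinates_eq p (x := inner y) hx rfl ((abs_neg _).trans (abs_of_pos y.2))))
  · exact (if_pos le_rfl).trans (congrArg upper (ofCoordinates_eq p (x := ray q r) hx rfl abs_zero))

theorem mem_range_chartAt {p : S} {x : Manifold n S} :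
    x ∈ range (chartAt p) ↔ footOf x = none ∨ footOf x = some p := by
  constructor
  · rintro ⟨y, rfl⟩
    exact footOf_chartAt p y
  · exact fun h => ⟨_, chartAt_coordinates p h⟩

theorem image_chartAt (p : S) (U : Set (Ambient n)) : chartAt p '' U =
    {x | (footOf x = none ∨ footOf x = some p) ∧ (slopeOf p x, signedHeight x) ∈ U} := by
  ext x
  constructor
  · rintro ⟨y, hy, rfl⟩
    refine ⟨footOf_chartAt p y, ?_⟩
    rwa [slopeOf_chartAt, signedHeight_chartAt]
  · exact fun h => ⟨_, h.2, chartAt_coordinates p h.1⟩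

theorem isOpenEmbedding_chartAt (p : S) : IsOpenEmbedding (chartAt p) := by
  refine .of_continuous_injective_isOpenMap (continuous_chartAt p) ?_ ?_
  · intro y z h
    refine Prod.ext ?_ ?_
    · rw [← slopeOf_chartAt p y, h, slopeOf_chartAt]
    · rw [← signedHeight_chartAt p y, h, signedHeight_chartAt]
  · intro U hU
    rw [image_chartAt, isOpen_manifold_iff]
    -- On the second copy the signed height is the negative of the height, whence the reflection.
    refine ⟨isOpen_coordinates p hU, isOpen_coordinates p (hU.preimage
      (f := fun y : Ambient n => ((y.1, -y.2) : Ambient n)) (by fun_prop))⟩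

/-- The chart is homeomorphic to a real vector space, which is contractible. -/
theorem isSimplyConnected_range_chartAt (p : S) : IsSimplyConnected (range (chartAt p)) :=
  (isOpenEmbedding_chartAt p).toHomeomorph.symm.toHomotopyEquiv.simplyConnectedSpace

instance : PathConnectedSpace (UpperHalf n) := by
  refine isPathConnected_iff_pathConnectedSpace (F := {x : Ambient n | 0 < x.2}).1 ?_
  exact (convex_halfSpace_gt (LinearMap.snd ℝ (Hyperplane n) ℝ).isLinear 0).isPathConnected
    ⟨((0, 1) : Ambient n), one_pos (α := ℝ)⟩

theorem range_upper_inner :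
    range (fun x => upper (inner x) : UpperHalf n → Manifold n S) = {x | 0 < signedHeight x} := by
  ext x
  constructor
  · rintro ⟨x, rfl⟩
    exact x.2
  · intro h
    rcases manifold_cases x with ⟨y, rfl⟩ | ⟨y, rfl⟩ | ⟨q, r, rfl⟩
    · exact ⟨y, rfl⟩
    · exact absurd h (neg_neg_of_pos y.2).not_gt
    · exact absurd h (lt_irrefl (0 : ℝ))

theorem range_lower_inner :
    range (fun x => lower (inner x) : UpperHalf n → Manifold n S) = {x | signedHeight x < 0} := by
  ext x
  constructor
  · rintro ⟨x, rfl⟩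
    exact neg_neg_of_pos x.2
  · intro h
    rcases manifold_cases x with ⟨y, rfl⟩ | ⟨y, rfl⟩ | ⟨q, r, rfl⟩
    · exact absurd h y.2.not_gt
    · exact ⟨y, rfl⟩
    · exact absurd h (lt_irrefl (0 : ℝ))

/-- The covering of the Prüfer manifold by the charts around its boundary components. -/
noncomputable def cover (p₀ : S) : TwoPieceCover (Manifold n S) S where
  chart p := range (chartAt p)
  front := range fun x => upper (inner x)
  back := range fun x => lower (inner x)
  isOpen_chart p := (isOpenEmbedding_chartAt p).isOpen_range
  isSimplyConnected_chart := isSimplyConnected_range_chartAt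
  exists_mem_chart x := by
    cases h : footOf x with
    | none => exact ⟨p₀, mem_range_chartAt.2 (Or.inl h)⟩
    | some p => exact ⟨p, mem_range_chartAt.2 (Or.inr h)⟩
  isOpen_front := by
    rw [range_upper_inner]
    exact isOpen_lt continuous_const continuous_signedHeight
  isOpen_back := by
    rw [range_lower_inner]
    exact isOpen_lt continuous_signedHeight continuous_const
  isPathConnected_front := isPathConnected_range (continuous_upper.comp continuous_inner)
  isPathConnected_back := isPathConnected_range (continuous_lower.comp continuous_inner)
  disjoint := by
    rw [range_upper_inner, range_lower_inner, disjoint_left]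
    exact fun x (h : 0 < signedHeight x) h' => lt_asymm h h'
  front_subset p := by
    rintro _ ⟨x, rfl⟩
    exact mem_range_chartAt.2 (Or.inl rfl)
  back_subset p := by
    rintro _ ⟨x, rfl⟩
    exact mem_range_chartAt.2 (Or.inl rfl)
  inter_subset p q hpq := by
    rintro x ⟨hp, hq⟩
    rw [mem_range_chartAt] at hp hq
    -- A boundary point has only one foot, so it cannot lie in the charts of two different points.
    have h : footOf x = none := hp.resolve_right fun h =>
      hpq (Option.some.inj (h.symm.trans (hq.resolve_left (h.symm ▸ Option.some_ne_none p))))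
    rcases manifold_cases x with ⟨y, rfl⟩ | ⟨y, rfl⟩ | ⟨q, r, rfl⟩
    · exact Or.inl ⟨y, rfl⟩
    · exact Or.inr ⟨y, rfl⟩
    · cases h

/-! ### The semicircle loops as loops of the cover -/

theorem foot_alphaPlusFun_of_ne_one (p q : S) {t : I} (ht : t ≠ 1) :
    (alphaPlusFun p q t).foot = none ∨ (alphaPlusFun p q t).foot = some p := by
  unfold alphaPlusFun
  split_ifs with h h0
  · exact Or.inl rfl
  · exact Or.inr rfl
  · by_cases hpq : p = q
    · exact Or.inr (congrArg some hpq.symm)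
    · exact absurd (semicircle_height_pos (fun e => hpq (Subtype.ext e)) h0 ht) h

theorem foot_alphaPlusFun_of_ne_zero (p q : S) {t : I} (ht : t ≠ 0) :
    (alphaPlusFun p q t).foot = none ∨ (alphaPlusFun p q t).foot = some q := by
  rw [← unitInterval.symm_symm t, alphaPlusFun_symm]
  refine foot_alphaPlusFun_of_ne_one q p fun h => ht ?_
  rw [← unitInterval.symm_symm t, h, unitInterval.symm_one]

theorem verticalPoint_mem_range_chartAt (p : S) : verticalPoint p ∈ range (chartAt p) :=
  mem_range_chartAt.2 (Or.inr rfl)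

open Path.Homotopic.Quotient in
/-- The class of the loop `α_{p,q}`, for any choice of the points in the two half-spaces. -/
theorem mk_alpha {p q : S} (hpq : q ≠ p) (p₀ : S) {a b : Manifold n S} (ha : a ∈ (cover p₀).front)
    (hb : b ∈ (cover p₀).back) : Path.Homotopic.Quotient.mk (alpha p q) =
      (cover p₀).loop p q (verticalPoint_mem_range_chartAt p) ha hb := by
  -- The top of the semicircle and its mirror image serve as transition points; time `1 / 2` is
  -- fixed by reversal.
  let h : I := ⟨1 / 2, by norm_num, by norm_num⟩
  have hh0 : h ≠ 0 := fun e => by simpa [h] using congrArg Subtype.val e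
  have hh1 : h ≠ 1 := fun e => by
    have := congrArg Subtype.val e
    norm_num [h] at this
  have hσ : unitInterval.symm h = h := Subtype.ext (by norm_num [h])
  have hpos := semicircle_height_pos (fun e : p.1 = q.1 => hpq (Subtype.ext e.symm)) hh0 hh1
  have hm : upper (alphaPlusFun p q h) ∈ (cover p₀).front :=
    ⟨⟨_, hpos⟩, congrArg upper (alphaPlusFun_of_pos hpos).symm⟩
  have hm' : lower (alphaPlusFun p q (unitInterval.symm h)) ∈ (cover p₀).back := by
    rw [hσ]
    exact ⟨⟨_, hpos⟩, congrArg lower (alphaPlusFun_of_pos hpos).symm⟩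
  have hP := (cover p₀).isSimplyConnected_chart p
  have hQ := (cover p₀).isSimplyConnected_chart q
  have h0 : ∀ t, t ≤ h → t ≠ 1 := fun t ht e => hh1 (le_antisymm le_top (e.symm.trans_le ht))
  have h1 : ∀ t, h ≤ t → t ≠ 0 := fun t ht e => hh0 (le_antisymm (ht.trans_eq e) bot_le)
  have hs0 : ∀ t, t ≤ h → unitInterval.symm t ≠ 0 := fun t ht e =>
    h0 t ht (by rw [← unitInterval.symm_symm t, e, unitInterval.symm_zero])
  have hs1 : ∀ t, h ≤ t → unitInterval.symm t ≠ 1 := fun t ht e =>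
    h1 t ht (by rw [← unitInterval.symm_symm t, e, unitInterval.symm_one])
  -- The four quarters of the loop lie in the charts `p`, `q`, `q`, `p`.
  have e₁ := mk_eq_within_trans_within hP hQ ((alphaPlus p q).map continuous_upper) h
    (fun t ht => mem_range_chartAt.2 (foot_alphaPlusFun_of_ne_one p q (h0 t ht)))
    (fun t ht => mem_range_chartAt.2 (foot_alphaPlusFun_of_ne_zero p q (h1 t ht)))
  have e₂ := mk_eq_within_trans_within hQ hP
    (((alphaPlus p q).symm.map continuous_lower).cast (upper_ray_eq_lower_ray q _)
      (upper_ray_eq_lower_ray p _)) h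
    (fun t ht => mem_range_chartAt.2 (foot_alphaPlusFun_of_ne_zero p q (hs0 t ht)))
    (fun t ht => mem_range_chartAt.2 (foot_alphaPlusFun_of_ne_one p q (hs1 t ht)))
  refine Eq.trans ?_ (TwoPieceCover.loop_congr p q _ hm hm' ha hb)
  refine (mk_trans _ _).trans ?_
  refine (congrArg₂ Path.Homotopic.Quotient.trans e₁ e₂).trans ?_
  refine (trans_assoc _ _ _).trans (congrArg _ ?_)
  -- The two middle quarters merge into one class in the chart `q`.
  exact within_trans_assoc hQ _ _ _ _

end Pruefer

theorem mainTheorem5 (n : ℕ) (hn : 2 ≤ n) (S : Set (EuclideanSpace ℝ (Fin (n - 1)))) (p₀ : S) :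
    ∃ e : FreeGroup {p : S // p ≠ p₀} ≃*
        FundamentalGroup (Pruefer.Manifold n S) (Pruefer.verticalPoint p₀),
      ∀ p : {p : S // p ≠ p₀}, e (FreeGroup.of p) =
        FundamentalGroup.fromPath (Path.Homotopic.Quotient.mk (Pruefer.alpha p₀ p.1)) := by
  -- Any point of the half-space would do, as `mk_alpha` allows arbitrary transition points.
  let x : Pruefer.UpperHalf n := ⟨(0, 1), one_pos⟩
  obtain ⟨e, he⟩ := (Pruefer.cover p₀).exists_freeGroup_mulEquiv
    (Pruefer.verticalPoint_mem_range_chartAt p₀) ⟨x, rfl⟩ ⟨x, rfl⟩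
  exact ⟨e, fun p => (he p).trans (congrArg FundamentalGroup.fromPath
    (Pruefer.mk_alpha p.2 p₀ _ _).symm)⟩
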